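/- Let $N$ be a connected smooth (finite-dimensional, without boundary) manifold endowed with a smooth Riemannian metric and the associated distance $d$. Let $u:N\to\mathbb R$ be locally Lipschitz. For $y\in N$, let $\partial^*u(y)\subset T_y^*N$ be the set of all $p$ for which there is a sequence $x_n$ of points of differentiability of $u$ such that $(x_n,d_{x_n}u)\to(y,p)$ in $T^*N$, and let the Clarke generalized derivative $\partial^c u(y)$ be the closed convex hull of $\partial^*u(y)$ in $T_y^*N$. Define the Clarke gauges $\partial^{\pm}u:TN\to\mathbb R$ by $$\partial^+u(x,v)=\sup\{p(v)\mid p\in\partial^c u(x)\},\qquad \partial^-u(x,v)=\inf\{p(v)\mid p\in\partial^c u(x)\}.$$ Then for every absolutely continuous path $\gamma:[a,b]\to N$ (with respect to $d$, where $a\le b$), the functions $t\mapsto\partial^{\pm}u(\gamma(t),\dot\gamma(t))$, which are defined for almost every $t$, are integrable on $[a,b]$, and $$\int_a^b\partial^-u(\gamma(t),\dot\gamma(t))\,dt\;\le\;u(\gamma(b))-u(\gamma(a))\;\le\;\int_a^b\partial^+u(\gamma(t),\dot\gamma(t))\,dt.$$ -/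

import Mathlib

open Set Filter Topology MeasureTheory Bundle
open scoped Manifold ContDiff

noncomputable section

namespace ClarkeCalculus

variable {E : Type*} [NormedAddCommGroup E] [NormedSpace ℝ E]
  {H : Type*} [TopologicalSpace H] (I : ModelWithCorners ℝ E H)
  {N : Type*} [TopologicalSpace N] [ChartedSpace H N]

/-- The cotangent space `T*_x N`: continuous linear forms on the tangent space `T_x N`. The target
is written `Bundle.Trivial N ℝ x`, which is `ℝ`, so that the family of these spaces is the hom
bundle of the tangent bundle and the trivial line bundle. -/
abbrev Cotangent (x : N) : Type _ := TangentSpace I x →L[ℝ] Bundle.Trivial N ℝ x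

variable (N) in
/-- The cotangent bundle `T*N`, with the topology of the hom bundle. -/
abbrev CotangentBundle : Type _ :=
  TotalSpace (E →L[ℝ] ℝ) (fun x : N ↦ Cotangent I x)

/-- The velocity `γ'(t)` of a path `γ : [a, b] → N`, as a tangent vector at `γ(t)`. -/
def velocity (γ : ℝ → N) (a b t : ℝ) : TangentSpace I (γ t) :=
  mfderivWithin 𝓘(ℝ, ℝ) I γ (Icc a b) t (1 : ℝ)

variable [IsManifold I ∞ N]

/-- The differential `d_x u` as a point of the cotangent space at `x`
(it is meaningful where `u` is differentiable). -/
def differential (u : N → ℝ) (x : N) : Cotangent I x := mvfderiv I u x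

/-- The set `∂*u(y)` of reachable derivatives of `u` at `y`: the `p ∈ T*_y N` for which there are
points `x_n` of differentiability of `u` with `(x_n, d_{x_n} u) → (y, p)` in `T*N`. -/
def reachableDeriv (u : N → ℝ) (y : N) : Set (Cotangent I y) :=
  {p | ∃ x : ℕ → N, (∀ n, MDifferentiableAt I 𝓘(ℝ, ℝ) u (x n)) ∧
    Tendsto (fun n ↦ (⟨x n, differential I u (x n)⟩ : CotangentBundle I N)) atTop
      (𝓝 (⟨y, p⟩ : CotangentBundle I N))}

/-- Clarke's generalized derivative `∂ᶜu(y)`: the closed convex hull of `∂*u(y)` in `T*_y N`. -/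
def clarkeDeriv (u : N → ℝ) (y : N) : Set (Cotangent I y) :=
  closure (convexHull ℝ (reachableDeriv I u y))

/-- The upper Clarke gauge `∂⁺u(x, v) = sup {p(v) | p ∈ ∂ᶜu(x)}`. -/
def upperGauge (u : N → ℝ) (x : N) (v : TangentSpace I x) : ℝ :=
  sSup ((fun p : Cotangent I x ↦ (p v : ℝ)) '' clarkeDeriv I u x)

/-- The lower Clarke gauge `∂⁻u(x, v) = inf {p(v) | p ∈ ∂ᶜu(x)}`. -/
def lowerGauge (u : N → ℝ) (x : N) (v : TangentSpace I x) : ℝ :=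
  sInf ((fun p : Cotangent I x ↦ (p v : ℝ)) '' clarkeDeriv I u x)

end ClarkeCalculus

end

/-!
The inequality is proved pointwise almost everywhere and then integrated. Since `u` is Lipschitz
on the compact image of `γ`, the function `u ∘ γ` is absolutely continuous, so `u (γ b) - u (γ a)
= ∫ (u ∘ γ)'`. It remains to show that almost everywhere `∂⁻u(γ, γ') ≤ (u ∘ γ)' ≤ ∂⁺u(γ, γ')`, and
that the gauges are integrable along `γ`. Both statements are local in time, hence may be checked
in a chart. As `∂⁻u(x, v) = -∂⁺u(x, -v)` (`lowerGauge_eq_neg_upperGauge_neg`), only the upper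
gauge has to be studied.

*In a vector space.* Let `f` be Lipschitz and let `G(z, w)` be the supremum of `p w` over the
limits `p` of derivatives of `f` at points tending to `z`. By compactness, for `ε > 0` and `y`
near `z`, every derivative `df_y` satisfies `df_y(w) ≤ G(z, w) + ε`
(`eventually_fderiv_apply_lt`). By Rademacher's theorem and Fubini, almost every segment in
direction `w` meets the points of non-differentiability in a null set, so that the bound
integrates to `f(y + t w) - f(y) ≤ t (G(z, w) + ε)`, first for almost every `y` and then for all
by continuity (`sub_le_mul_of_fderiv_apply_le`). Comparing a differentiable path with its tangent
line yields `(f ∘ c)' ≤ G(c, c')` wherever both derivatives exist (`deriv_comp_le_limitingGauge`).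
Moreover `G` is upper semicontinuous, hence Borel, and `|G(z, w)| ≤ K ‖w‖`, which gives the
integrability.

*In a chart.* Near its centre a chart of a Riemannian manifold is bi-Lipschitz
(`exists_lipschitzOnWith_extChartAt`, `exists_lipschitzOnWith_extChartAt_symm`). Thus it turns `γ`
into an absolutely continuous path of `E`, and `u` into a Lipschitz function on a neighbourhood,
which is extended to a Lipschitz function `g` on all of `E` (`exists_lipschitz_representative`).
The trivialization of the cotangent bundle over the chart identifies the reachable derivatives of
`u` with the limiting derivatives of `g` (`reachableDeriv_eq_image_limitingFDeriv`). A linear form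
has the same supremum over a set and over its closed convex hull, so `∂⁺u` is `G` read in the
chart (`upperGauge_eq_limitingGauge`).
-/

namespace ClarkeCalculus

/-! ### Limiting derivatives of a Lipschitz function on a vector space -/

section Euclidean

open scoped NNReal

variable {E : Type*} [NormedAddCommGroup E] [NormedSpace ℝ E]

/-- The limiting derivatives of `f` at `z`: the limits of `fderiv ℝ f (x n)` along sequences of
points of differentiability `x n` tending to `z`. -/
def limitingFDeriv (f : E → ℝ) (z : E) : Set (E →L[ℝ] ℝ) :=
  {p | ∃ x : ℕ → E, (∀ n, DifferentiableAt ℝ f (x n)) ∧ Tendsto x atTop (𝓝 z) ∧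
    Tendsto (fun n ↦ fderiv ℝ f (x n)) atTop (𝓝 p)}

/-- The support function of the limiting derivatives of `f` at `z`. Passing to the closed convex
hull does not change it, so it is the upper Clarke gauge of `f`. -/
noncomputable def limitingGauge (f : E → ℝ) (z w : E) : ℝ :=
  sSup ((fun p : E →L[ℝ] ℝ ↦ p w) '' limitingFDeriv f z)

variable {f : E → ℝ} {K : ℝ≥0} {z w : E}

lemma norm_le_of_mem_limitingFDeriv (hf : LipschitzWith K f) {p : E →L[ℝ] ℝ}
    (hp : p ∈ limitingFDeriv f z) : ‖p‖ ≤ K := by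
  obtain ⟨x, -, -, h⟩ := hp
  exact le_of_tendsto h.norm (.of_forall fun n ↦ norm_fderiv_le_of_lipschitz ℝ hf)

lemma abs_apply_le_of_mem_limitingFDeriv (hf : LipschitzWith K f) {p : E →L[ℝ] ℝ}
    (hp : p ∈ limitingFDeriv f z) (w : E) : |p w| ≤ K * ‖w‖ :=
  p.le_of_opNorm_le (norm_le_of_mem_limitingFDeriv hf hp) w

lemma bddAbove_image_limitingFDeriv (hf : LipschitzWith K f) (z w : E) :
    BddAbove ((fun p : E →L[ℝ] ℝ ↦ p w) '' limitingFDeriv f z) := by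
  refine ⟨K * ‖w‖, ?_⟩
  rintro _ ⟨p, hp, rfl⟩
  exact (le_abs_self _).trans (abs_apply_le_of_mem_limitingFDeriv hf hp w)

lemma apply_le_limitingGauge (hf : LipschitzWith K f) {p : E →L[ℝ] ℝ}
    (hp : p ∈ limitingFDeriv f z) : p w ≤ limitingGauge f z w :=
  le_csSup (bddAbove_image_limitingFDeriv hf z w) (mem_image_of_mem _ hp)

variable [FiniteDimensional ℝ E]

/-- Bounded derivatives at points tending to `z` accumulate at a limiting derivative at `z`. -/
lemma exists_subseq_tendsto_limitingFDeriv (hf : LipschitzWith K f) {x : ℕ → E}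
    (hx : ∀ n, DifferentiableAt ℝ f (x n)) (hz : Tendsto x atTop (𝓝 z)) :
    ∃ p ∈ limitingFDeriv f z, ∃ φ : ℕ → ℕ, StrictMono φ ∧
      Tendsto (fun n ↦ fderiv ℝ f (x (φ n))) atTop (𝓝 p) := by
  have : ProperSpace (E →L[ℝ] ℝ) := FiniteDimensional.proper ℝ _
  obtain ⟨p, -, φ, hφ, hp⟩ := tendsto_subseq_of_bounded
    (Metric.isBounded_closedBall (x := (0 : E →L[ℝ] ℝ)) (r := K)) (x := fun n ↦ fderiv ℝ f (x n))
    (fun n ↦ by simpa using norm_fderiv_le_of_lipschitz ℝ hf)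
  exact ⟨p, ⟨x ∘ φ, fun n ↦ hx _, hz.comp hφ.tendsto_atTop, hp⟩, φ, hφ, hp⟩

lemma limitingFDeriv_nonempty (hf : LipschitzWith K f) (z : E) : (limitingFDeriv f z).Nonempty := by
  borelize E
  have hd : Dense {x | DifferentiableAt ℝ f x} :=
    Measure.dense_of_ae (hf.ae_differentiableAt (μ := Measure.addHaar))
  obtain ⟨x, hx, hz⟩ := mem_closure_iff_seq_limit.1 (hd z)
  obtain ⟨p, hp, -⟩ := exists_subseq_tendsto_limitingFDeriv hf hx hz
  exact ⟨p, hp⟩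

lemma abs_limitingGauge_le (hf : LipschitzWith K f) (z w : E) :
    |limitingGauge f z w| ≤ K * ‖w‖ := by
  obtain ⟨p, hp⟩ := limitingFDeriv_nonempty hf z
  refine abs_le.2 ⟨(abs_le.1 (abs_apply_le_of_mem_limitingFDeriv hf hp w)).1.trans
    (apply_le_limitingGauge hf hp), csSup_le ⟨_, mem_image_of_mem _ hp⟩ ?_⟩
  rintro _ ⟨q, hq, rfl⟩
  exact (abs_le.1 (abs_apply_le_of_mem_limitingFDeriv hf hq w)).2

/-- By compactness, the derivatives of `f` at points near `z` almost obey the bound that the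
limiting derivatives at `z` satisfy. -/
lemma eventually_fderiv_apply_lt (hf : LipschitzWith K f) (z w : E) {M : ℝ}
    (hM : limitingGauge f z w < M) :
    ∀ᶠ y in 𝓝 z, DifferentiableAt ℝ f y → fderiv ℝ f y w < M := by
  by_contra h
  obtain ⟨x, hz, hx⟩ := exists_seq_forall_of_frequently (not_eventually.1 h)
  push Not at hx
  obtain ⟨p, hp, φ, -, hφ⟩ := exists_subseq_tendsto_limitingFDeriv hf (fun n ↦ (hx n).1) hz
  have h1 : Tendsto (fun n ↦ fderiv ℝ f (x (φ n)) w) atTop (𝓝 (p w)) :=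
    ((ContinuousLinearMap.apply ℝ ℝ w).continuous.tendsto p).comp hφ
  exact (hM.trans_le (ge_of_tendsto h1 (.of_forall fun n ↦ (hx _).2))).not_ge
    (apply_le_limitingGauge hf hp)

/-- A bound on the derivative in direction `w` at the points of differentiability in a ball bounds
the increments of `f` in direction `w`. By Rademacher's theorem and Fubini, almost every segment in
direction `w` consists of points of differentiability, up to a null set of parameters; the other
segments are limits of these. -/
lemma sub_le_mul_of_fderiv_apply_le (hf : LipschitzWith K f) {r M t : ℝ}
    (hM : ∀ y ∈ Metric.ball z r, DifferentiableAt ℝ f y → fderiv ℝ f y w ≤ M) (ht : 0 ≤ t) {y : E}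
    (hy : y ∈ Metric.ball z r) (hyt : y + t • w ∈ Metric.ball z r) :
    f (y + t • w) - f y ≤ t * M := by
  borelize E
  let μ : Measure E := Measure.addHaar
  have hD : MeasurableSet {x | DifferentiableAt ℝ f x} := measurableSet_of_differentiableAt ℝ f
  have h1 : ∀ᵐ x ∂μ, ∀ᵐ s : ℝ, DifferentiableAt ℝ f (x + s • w) := by
    refine (Measure.ae_ae_comm (p := fun (s : ℝ) (x : E) ↦ DifferentiableAt ℝ f (x + s • w))
      ?_).1 (.of_forall fun s ↦ ?_)
    · have : ProperSpace E := FiniteDimensional.proper ℝ E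
      have : SecondCountableTopology E := secondCountable_of_proper
      exact hD.preimage (by fun_prop : Continuous fun q : ℝ × E ↦ q.2 + q.1 • w).measurable
    · exact (measurePreserving_add_right μ (s • w)).quasiMeasurePreserving.ae
        (hf.ae_differentiableAt (μ := μ))
  have h2 : ∃ᶠ x in 𝓝 y, ∀ᵐ s : ℝ, DifferentiableAt ℝ f (x + s • w) :=
    mem_closure_iff_frequently.1 (Measure.dense_of_ae h1 y)
  have hcont : Tendsto (fun x ↦ f (x + t • w) - f x) (𝓝 y) (𝓝 (f (y + t • w) - f y)) := by
    have := hf.continuous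
    exact (by fun_prop : Continuous fun x ↦ f (x + t • w) - f x).tendsto y
  refine le_of_tendsto_of_frequently hcont ?_
  have h3 : ∀ᶠ x in 𝓝 y, x ∈ Metric.ball z r ∧ x + t • w ∈ Metric.ball z r :=
    Eventually.and (Metric.isOpen_ball.mem_nhds hy)
      ((by fun_prop : Continuous fun x : E ↦ x + t • w).continuousAt.preimage_mem_nhds
        (Metric.isOpen_ball.mem_nhds hyt))
  refine (h2.and_eventually h3).mono ?_
  rintro x ⟨hx, hx0, hxt⟩
  have hlip : LipschitzWith (K * ‖w‖₊) fun s : ℝ ↦ f (x + s • w) := by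
    refine hf.comp (LipschitzWith.of_dist_le_mul fun s s' ↦ ?_)
    rw [dist_add_left, dist_eq_norm, ← sub_smul, norm_smul, mul_comm, ← dist_eq_norm]
    rfl
  have hac := (hlip.lipschitzOnWith (s := uIcc 0 t)).absolutelyContinuousOnInterval
  have hint := hac.integral_deriv_eq_sub
  simp only [zero_smul, add_zero] at hint
  rw [← hint]
  calc ∫ s in (0 : ℝ)..t, deriv (fun s : ℝ ↦ f (x + s • w)) s
      ≤ ∫ s in (0 : ℝ)..t, M := by
        refine intervalIntegral.integral_mono_ae_restrict ht hac.intervalIntegrable_deriv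
          intervalIntegrable_const ?_
        rw [EventuallyLE, ae_restrict_iff' measurableSet_Icc]
        filter_upwards [hx] with s hs hst
        have hd : HasDerivAt (fun s : ℝ ↦ f (x + s • w)) (fderiv ℝ f (x + s • w) w) s := by
          refine hs.hasFDerivAt.comp_hasDerivAt s ?_
          simpa using ((hasDerivAt_id s).smul_const w).const_add x
        rw [hd.deriv]
        refine hM _ ?_ hs
        -- `x + s • w` lies on the segment from `x` to `x + t • w`
        rcases ht.eq_or_lt with rfl | ht'
        · obtain rfl : s = 0 := le_antisymm hst.2 hst.1
          simpa using hx0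
        · have := (convex_ball z r).add_smul_sub_mem hx0 hxt
            (t := s / t) ⟨div_nonneg hst.1 ht, (div_le_one ht').2 hst.2⟩
          simpa [smul_smul, div_mul_cancel₀ _ ht'.ne'] using this
    _ = t * M := by simp

/-- Chain inequality: along a differentiable path `c`, the derivative of `f ∘ c` is at most the
gauge of `f` at the velocity of `c`. -/
lemma deriv_comp_le_limitingGauge (hf : LipschitzWith K f) {c : ℝ → E} {t d : ℝ}
    (hc : HasDerivAt c w t) (hd : HasDerivAt (fun s ↦ f (c s)) d t) :
    d ≤ limitingGauge f (c t) w := by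
  refine le_of_forall_pos_le_add fun ε hε ↦ ?_
  obtain ⟨r, hr, hball⟩ := Metric.eventually_nhds_iff_ball.1 (eventually_fderiv_apply_lt hf (c t) w
    (lt_add_of_pos_right (limitingGauge f (c t) w) hε))
  -- the quotients of `f ∘ c` differ from those of `f` along the tangent line by a null sequence
  have h1 : Tendsto (fun h : ℝ ↦ h⁻¹ • (f (c (t + h)) - f (c t))) (𝓝[>] 0) (𝓝 d) :=
    (hd.tendsto_slope_zero).mono_left (nhdsWithin_mono _ fun _ h ↦ (ne_of_gt h))
  have h2 : Tendsto (fun h : ℝ ↦ (limitingGauge f (c t) w + ε) +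
      K * ‖h⁻¹ • (c (t + h) - c t) - w‖) (𝓝[>] 0)
      (𝓝 ((limitingGauge f (c t) w + ε) + K * ‖w - w‖)) := by
    refine tendsto_const_nhds.add (tendsto_const_nhds.mul (Tendsto.norm (Tendsto.sub ?_
      tendsto_const_nhds)))
    exact (hc.tendsto_slope_zero).mono_left (nhdsWithin_mono _ fun _ h ↦ (ne_of_gt h))
  rw [sub_self, norm_zero, mul_zero, add_zero] at h2
  refine le_of_tendsto_of_tendsto h1 h2 ?_
  have h3 : ∀ᶠ h : ℝ in 𝓝[>] 0, c t + h • w ∈ Metric.ball (c t) r := by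
    refine nhdsWithin_le_nhds ((by fun_prop : Continuous fun h : ℝ ↦
      c t + h • w).continuousAt.preimage_mem_nhds (Metric.isOpen_ball.mem_nhds ?_))
    simpa using hr
  filter_upwards [h3, self_mem_nhdsWithin] with h hh (hpos : 0 < h)
  have h4 : f (c t + h • w) - f (c t) ≤ h * (limitingGauge f (c t) w + ε) :=
    sub_le_mul_of_fderiv_apply_le hf (fun y hy hyd ↦ (hball y hy hyd).le) hpos.le
      (Metric.mem_ball_self hr) hh
  have h5 : f (c (t + h)) - f (c t + h • w) ≤ K * ‖c (t + h) - (c t + h • w)‖ := by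
    rw [← dist_eq_norm]
    exact (le_abs_self _).trans (hf.dist_le_mul _ _)
  have h6 : c (t + h) - (c t + h • w) = h • (h⁻¹ • (c (t + h) - c t) - w) := by
    rw [smul_sub, smul_smul, mul_inv_cancel₀ hpos.ne', one_smul]; abel
  rw [h6, norm_smul, Real.norm_of_nonneg hpos.le] at h5
  rw [smul_eq_mul, inv_mul_le_iff₀ hpos]
  linarith

/-- The gauge is upper semicontinuous jointly in the base point and the direction. -/
lemma upperSemicontinuous_limitingGauge (hf : LipschitzWith K f) :
    UpperSemicontinuous fun q : E × E ↦ limitingGauge f q.1 q.2 := by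
  rintro ⟨z, w⟩ M hM
  obtain ⟨M', hM', hM''⟩ := exists_between (α := ℝ) hM
  have h1 := (eventually_fderiv_apply_lt hf z w hM').eventually_nhds
  have h2 : ∀ᶠ v in 𝓝 w, M' + K * ‖v - w‖ < M := by
    refine ((by fun_prop : Continuous fun v : E ↦ M' + K * ‖v - w‖).continuousAt
      (x := w)).eventually_lt_const ?_
    simpa using hM''
  rw [nhds_prod_eq]
  filter_upwards [h1.prod_mk h2] with ⟨y, v⟩ ⟨hy, hv⟩
  refine lt_of_le_of_lt (csSup_le ((limitingFDeriv_nonempty hf y).image _) ?_) hv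
  rintro _ ⟨p, hp, rfl⟩
  obtain ⟨x, hx, hxy, hxp⟩ := hp
  have h3 : Tendsto (fun n ↦ fderiv ℝ f (x n) w) atTop (𝓝 (p w)) :=
    ((ContinuousLinearMap.apply ℝ ℝ w).continuous.tendsto p).comp hxp
  have h4 : p w ≤ M' := le_of_tendsto h3 ((hxy.eventually hy).mono fun n hn ↦ (hn (hx n)).le)
  have h5 := (le_abs_self _).trans
    (abs_apply_le_of_mem_limitingFDeriv hf ⟨x, hx, hxy, hxp⟩ (v - w))
  rw [map_sub] at h5
  change p v ≤ _
  linarith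

end Euclidean

/-! ### Charts of a Riemannian manifold are locally bi-Lipschitz -/

section Riemannian

open scoped NNReal ENNReal
open Manifold

variable {E : Type*} [NormedAddCommGroup E] [NormedSpace ℝ E]
  {N : Type*} [MetricSpace N] [ChartedSpace E N] [IsManifold 𝓘(ℝ, E) ∞ N]
  [RiemannianBundle (fun x : N ↦ TangentSpace 𝓘(ℝ, E) x)]

-- Tangent spaces to `E` itself carry the norm of `E`.
attribute [local instance] normedAddCommGroupTangentSpaceVectorSpace
attribute [local instance] normedSpaceTangentSpaceVectorSpace

/-- In a region of the chart domain where the derivative of the chart is bounded by `C`, the chart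
increases the length of paths at most by the factor `C`. -/
lemma enorm_extChartAt_sub_le_mul_pathELength {x₀ : N} {C : ℝ≥0} {s : Set N}
    (hs : s ⊆ (chartAt E x₀).source)
    (hC : ∀ y ∈ s, ∀ v : TangentSpace 𝓘(ℝ, E) y,
      ‖(mfderiv 𝓘(ℝ, E) 𝓘(ℝ, E) (extChartAt 𝓘(ℝ, E) x₀) y v : E)‖ₑ ≤ C * ‖v‖ₑ)
    {η : ℝ → N} (hη : ContMDiff 𝓘(ℝ, ℝ) 𝓘(ℝ, E) 1 η) (hηs : ∀ t ∈ Icc (0 : ℝ) 1, η t ∈ s) :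
    ‖extChartAt 𝓘(ℝ, E) x₀ (η 1) - extChartAt 𝓘(ℝ, E) x₀ (η 0)‖ₑ ≤
      C * pathELength 𝓘(ℝ, E) η 0 1 := by
  let c := extChartAt 𝓘(ℝ, E) x₀ ∘ η
  have hc : ContMDiffOn 𝓘(ℝ, ℝ) 𝓘(ℝ, E) 1 c (Icc 0 1) :=
    contMDiffOn_extChartAt.comp (I' := 𝓘(ℝ, E)) (t := (chartAt E x₀).source)
      hη.contMDiffOn (fun t ht ↦ hs (hηs t ht))
  calc ‖c 1 - c 0‖ₑ
    _ ≤ ∫⁻ t in Icc 0 1, ‖derivWithin c (Icc 0 1) t‖ₑ := by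
      apply enorm_sub_le_lintegral_derivWithin_Icc_of_contDiffOn_Icc _ zero_le_one
      rwa [← contMDiffOn_iff_contDiffOn]
    _ ≤ ∫⁻ t in Icc 0 1, C * ‖mfderivWithin 𝓘(ℝ, ℝ) 𝓘(ℝ, E) η (Icc 0 1) t (1 : ℝ)‖ₑ := by
      apply setLIntegral_mono' measurableSet_Icc (fun t ht ↦ ?_)
      have h1 : mfderivWithin 𝓘(ℝ, ℝ) 𝓘(ℝ, E) c (Icc 0 1) t =
          (mfderiv 𝓘(ℝ, E) 𝓘(ℝ, E) (extChartAt 𝓘(ℝ, E) x₀) (η t)).comp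
            (mfderivWithin 𝓘(ℝ, ℝ) 𝓘(ℝ, E) η (Icc 0 1) t) := by
        apply mfderiv_comp_mfderivWithin
        · exact mdifferentiableAt_extChartAt (hs (hηs t ht))
        · exact (hη.mdifferentiable one_ne_zero).mdifferentiableOn _ ht
        · rw [uniqueMDiffWithinAt_iff_uniqueDiffWithinAt]
          exact uniqueDiffOn_Icc zero_lt_one _ ht
      have h2 : derivWithin c (Icc 0 1) t =
          mfderiv 𝓘(ℝ, E) 𝓘(ℝ, E) (extChartAt 𝓘(ℝ, E) x₀) (η t)
            (mfderivWithin 𝓘(ℝ, ℝ) 𝓘(ℝ, E) η (Icc 0 1) t (1 : ℝ)) := by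
        rw [← fderivWithin_derivWithin, ← mfderivWithin_eq_fderivWithin]
        exact congr($h1 (1 : ℝ))
      rw [h2]
      exact hC _ (hηs t ht) _
    _ = C * pathELength 𝓘(ℝ, E) η 0 1 := by
      rw [lintegral_const_mul' _ _ ENNReal.coe_ne_top,
        pathELength_eq_lintegral_mfderivWithin_Icc]
      rfl

variable [IsContMDiffRiemannianBundle 𝓘(ℝ, E) ∞ E (fun x : N ↦ TangentSpace 𝓘(ℝ, E) x)]

variable (E N) in
lemma isContinuousRiemannianBundle_tangentSpace :
    IsContinuousRiemannianBundle E (fun x : N ↦ TangentSpace 𝓘(ℝ, E) x) := by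
  obtain ⟨g, hg, h⟩ := IsContMDiffRiemannianBundle.exists_contMDiff (IB := 𝓘(ℝ, E)) (n := ∞)
    (F := E) (E := fun x : N ↦ TangentSpace 𝓘(ℝ, E) x)
  exact ⟨g, hg.continuous, h⟩

lemma eventually_enorm_mfderiv_extChartAt_apply_le (x₀ : N) :
    ∃ C : ℝ≥0, ∀ᶠ y in 𝓝 x₀, ∀ v : TangentSpace 𝓘(ℝ, E) y,
      ‖(mfderiv 𝓘(ℝ, E) 𝓘(ℝ, E) (extChartAt 𝓘(ℝ, E) x₀) y v : E)‖ₑ ≤ C * ‖v‖ₑ := by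
  have := isContinuousRiemannianBundle_tangentSpace E N
  obtain ⟨C, -, hC⟩ := eventually_enorm_mfderiv_extChartAt_lt 𝓘(ℝ, E) x₀
  refine ⟨C, hC.mono fun y hy v ↦ ?_⟩
  refine (ContinuousLinearMap.le_opENorm
    (mfderiv 𝓘(ℝ, E) 𝓘(ℝ, E) (extChartAt 𝓘(ℝ, E) x₀) y) v).trans ?_
  gcongr
  exact hy.le

lemma eventually_enorm_mfderivWithin_symm_extChartAt_apply_le (x₀ : N) :
    ∃ C : ℝ≥0, ∀ᶠ y in 𝓝 (extChartAt 𝓘(ℝ, E) x₀ x₀), ∀ v : E,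
      ‖mfderiv 𝓘(ℝ, E) 𝓘(ℝ, E) (extChartAt 𝓘(ℝ, E) x₀).symm y v‖ₑ ≤ C * ‖v‖ₑ := by
  have := isContinuousRiemannianBundle_tangentSpace E N
  obtain ⟨C, -, hC⟩ := eventually_enorm_mfderivWithin_symm_extChartAt_lt 𝓘(ℝ, E) x₀
  simp only [modelWithCornersSelf_coe, range_id, nhdsWithin_univ, mfderivWithin_univ] at hC
  refine ⟨C, hC.mono fun y hy v ↦ ?_⟩
  refine (ContinuousLinearMap.le_opENorm
    (mfderiv 𝓘(ℝ, E) 𝓘(ℝ, E) (extChartAt 𝓘(ℝ, E) x₀).symm y) v).trans ?_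
  gcongr
  · exact hy.le
  · exact le_rfl


/-- A chart is Lipschitz near its centre: almost minimizing paths between two points near `x₀` stay
in a fixed ball around `x₀`, where the derivative of the chart is bounded. -/
lemma exists_lipschitzOnWith_extChartAt [IsRiemannianManifold 𝓘(ℝ, E) N] (x₀ : N) :
    ∃ C : ℝ≥0, ∃ s ∈ 𝓝 x₀, LipschitzOnWith C (extChartAt 𝓘(ℝ, E) x₀) s := by
  obtain ⟨C, hC⟩ := eventually_enorm_mfderiv_extChartAt_apply_le (E := E) x₀
  obtain ⟨r, hr, hball⟩ := EMetric.mem_nhds_iff.1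
    (inter_mem (chart_source_mem_nhds E x₀) hC)
  obtain ⟨ρ, hρ, hρr⟩ : ∃ ρ > 0, ρ + (ρ + ρ) ≤ r := by
    refine ⟨r / 3, ENNReal.div_pos hr.ne' (by simp), ?_⟩
    rw [← add_assoc, ENNReal.add_thirds]
  refine ⟨C, Metric.eball x₀ ρ, Metric.eball_mem_nhds _ hρ, fun y hy z hz ↦ ?_⟩
  have hyz : edist y z < ρ + ρ :=
    (edist_triangle_right y z x₀).trans_lt (ENNReal.add_lt_add hy hz)
  -- it suffices to bound by `C * δ` for all `δ` slightly larger than the distance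
  suffices h : ∀ δ : ℝ≥0∞, edist y z < δ → δ ≤ ρ + ρ →
      edist (extChartAt 𝓘(ℝ, E) x₀ y) (extChartAt 𝓘(ℝ, E) x₀ z) ≤ C * δ by
    have hlim : Tendsto (fun δ : ℝ≥0∞ ↦ C * δ) (𝓝[>] (edist y z)) (𝓝 (C * edist y z)) :=
      (ENNReal.Tendsto.const_mul tendsto_id (Or.inr ENNReal.coe_ne_top)).mono_left
        nhdsWithin_le_nhds
    have : (𝓝[>] (edist y z)).NeBot := nhdsGT_neBot_of_exists_gt ⟨_, hyz⟩
    refine ge_of_tendsto hlim ?_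
    filter_upwards [Ioc_mem_nhdsGT hyz] with δ hδ using h δ hδ.1 hδ.2
  intro δ hδ hδρ
  rw [IsRiemannianManifold.out (I := 𝓘(ℝ, E)) y z] at hδ
  obtain ⟨η, hη0, hη1, hη, hlen, -⟩ :=
    exists_lt_locally_constant_of_riemannianEDist_lt hδ zero_lt_one
  have hηs : ∀ t ∈ Icc (0 : ℝ) 1, η t ∈ Metric.eball x₀ r := by
    intro t ht
    have h1 : edist y (η t) < ρ + ρ := by
      rw [IsRiemannianManifold.out (I := 𝓘(ℝ, E)) y (η t)]
      calc riemannianEDist 𝓘(ℝ, E) y (η t) ≤ pathELength 𝓘(ℝ, E) η 0 t :=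
            riemannianEDist_le_pathELength hη.contMDiffOn hη0 rfl ht.1
        _ ≤ pathELength 𝓘(ℝ, E) η 0 1 := pathELength_mono le_rfl ht.2
        _ < ρ + ρ := hlen.trans_le hδρ
    rw [Metric.mem_eball, edist_comm]
    calc edist x₀ (η t) ≤ edist x₀ y + edist y (η t) := edist_triangle _ _ _
      _ < ρ + (ρ + ρ) := ENNReal.add_lt_add (by rwa [edist_comm]) h1
      _ ≤ r := hρr
  have h1 := enorm_extChartAt_sub_le_mul_pathELength (fun y hy ↦ (hball hy).1)
    (fun y hy ↦ (hball hy).2) hη hηs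
  rw [edist_comm, edist_eq_enorm_sub, ← hη0, ← hη1]
  refine h1.trans ?_
  gcongr

/-- The inverse of a chart is Lipschitz near the centre: it maps segments in a small ball to paths
of comparable length. -/
lemma exists_lipschitzOnWith_extChartAt_symm [IsRiemannianManifold 𝓘(ℝ, E) N] (x₀ : N) :
    ∃ C : ℝ≥0, ∃ s ∈ 𝓝 (extChartAt 𝓘(ℝ, E) x₀ x₀),
      LipschitzOnWith C (extChartAt 𝓘(ℝ, E) x₀).symm s := by
  obtain ⟨C, hC⟩ := eventually_enorm_mfderivWithin_symm_extChartAt_apply_le (E := E) x₀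
  obtain ⟨r, hr, hball⟩ := Metric.mem_nhds_iff.1
    (inter_mem (extChartAt_target_mem_nhds (I := 𝓘(ℝ, E)) x₀) hC)
  refine ⟨C, Metric.ball _ r, Metric.ball_mem_nhds _ hr, fun y hy z hz ↦ ?_⟩
  let η := ContinuousAffineMap.lineMap (R := ℝ) y z
  set c := (extChartAt 𝓘(ℝ, E) x₀).symm ∘ η
  have hη : MapsTo η (Icc 0 1) (Metric.ball (extChartAt 𝓘(ℝ, E) x₀ x₀) r) := by
    rw [mapsTo_iff_image_subset]
    simp only [ContinuousAffineMap.coe_lineMap_eq, ← segment_eq_image_lineMap, η]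
    exact (convex_ball _ _).segment_subset hy hz
  have hηt : MapsTo η (Icc 0 1) (extChartAt 𝓘(ℝ, E) x₀).target := fun t ht ↦ (hball (hη ht)).1
  have η_smooth : ContMDiff 𝓘(ℝ, ℝ) 𝓘(ℝ, E) 1 η := by
    rw [contMDiff_iff_contDiff]
    exact ContinuousAffineMap.contDiff _
  have hle : riemannianEDist 𝓘(ℝ, E) ((extChartAt 𝓘(ℝ, E) x₀).symm y)
      ((extChartAt 𝓘(ℝ, E) x₀).symm z) ≤ pathELength 𝓘(ℝ, E) c 0 1 := by
    apply riemannianEDist_le_pathELength _ _ _ zero_le_one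
    · exact (contMDiffOn_extChartAt_symm x₀).comp η_smooth.contMDiffOn hηt
    · simp [c, η, ContinuousAffineMap.coe_lineMap_eq]
    · simp [c, η, ContinuousAffineMap.coe_lineMap_eq]
  rw [IsRiemannianManifold.out (I := 𝓘(ℝ, E))]
  refine hle.trans ?_
  rw [← lintegral_fderiv_lineMap_eq_edist, pathELength_eq_lintegral_mfderivWithin_Icc,
    ← lintegral_const_mul' _ _ ENNReal.coe_ne_top]
  apply setLIntegral_mono' measurableSet_Icc (fun t ht ↦ ?_)
  have h1 : mfderivWithin 𝓘(ℝ, ℝ) 𝓘(ℝ, E) c (Icc 0 1) t =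
      (mfderiv 𝓘(ℝ, E) 𝓘(ℝ, E) (extChartAt 𝓘(ℝ, E) x₀).symm (η t)).comp
        (mfderivWithin 𝓘(ℝ, ℝ) 𝓘(ℝ, E) η (Icc 0 1) t) := by
    apply mfderiv_comp_mfderivWithin
    · have := mdifferentiableWithinAt_extChartAt_symm (I := 𝓘(ℝ, E)) (hηt ht)
      rwa [modelWithCornersSelf_coe, range_id, mdifferentiableWithinAt_univ] at this
    · exact (η_smooth.mdifferentiable one_ne_zero).mdifferentiableOn _ ht
    · rw [uniqueMDiffWithinAt_iff_uniqueDiffWithinAt]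
      exact uniqueDiffOn_Icc zero_lt_one t ht
  have h2 : mfderivWithin 𝓘(ℝ, ℝ) 𝓘(ℝ, E) c (Icc 0 1) t (1 : ℝ) =
      mfderiv 𝓘(ℝ, E) 𝓘(ℝ, E) (extChartAt 𝓘(ℝ, E) x₀).symm (η t)
        (fderivWithin ℝ η (Icc 0 1) t (1 : ℝ)) := by
    rw [← mfderivWithin_eq_fderivWithin]
    exact congr($h1 (1 : ℝ))
  exact (congrArg (‖·‖ₑ) h2).trans_le ((hball (hη ht)).2 _)

/-- Near each point, a locally Lipschitz function is the composition of a Lipschitz chart with a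
function that is Lipschitz on the whole model space. -/
lemma exists_lipschitz_representative [IsRiemannianManifold 𝓘(ℝ, E) N] {u : N → ℝ}
    (hu : LocallyLipschitz u) (x₀ : N) :
    ∃ (K K' : ℝ≥0) (g : E → ℝ) (V : Set N), IsOpen V ∧ x₀ ∈ V ∧ V ⊆ (chartAt E x₀).source ∧
      LipschitzOnWith K' (extChartAt 𝓘(ℝ, E) x₀) V ∧ LipschitzWith K g ∧
      EqOn u (g ∘ extChartAt 𝓘(ℝ, E) x₀) V := by
  obtain ⟨L, t, ht, hL⟩ := hu x₀
  obtain ⟨K', s, hs, hK'⟩ := exists_lipschitzOnWith_extChartAt (E := E) x₀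
  obtain ⟨C, W, hW, hC⟩ := exists_lipschitzOnWith_extChartAt_symm (E := E) x₀
  have hlip : LipschitzOnWith (L * C) (u ∘ (extChartAt 𝓘(ℝ, E) x₀).symm)
      (W ∩ (extChartAt 𝓘(ℝ, E) x₀).symm ⁻¹' t) :=
    hL.comp (hC.mono inter_subset_left) (fun y hy ↦ hy.2)
  obtain ⟨g, hg, hug⟩ := hlip.extend_real
  have hmem : (s ∩ (extChartAt 𝓘(ℝ, E) x₀).source) ∩ (extChartAt 𝓘(ℝ, E) x₀ ⁻¹' W ∩ t) ∈ 𝓝 x₀ :=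
    inter_mem (inter_mem hs (extChartAt_source_mem_nhds x₀))
      (inter_mem ((continuousAt_extChartAt x₀).preimage_mem_nhds hW) ht)
  obtain ⟨V, hVsub, hV, hxV⟩ := mem_nhds_iff.1 hmem
  refine ⟨L * C, K', g, V, hV, hxV, fun x hx ↦ ?_, hK'.mono fun x hx ↦ (hVsub hx).1.1, hg,
    fun x hx ↦ ?_⟩
  · rw [← extChartAt_source 𝓘(ℝ, E)]
    exact (hVsub hx).1.2
  · have hx' := (extChartAt 𝓘(ℝ, E) x₀).left_inv (hVsub hx).1.2
    have := hug (x := extChartAt 𝓘(ℝ, E) x₀ x)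
      ⟨(hVsub hx).2.1, by rw [mem_preimage, hx']; exact (hVsub hx).2.2⟩
    rw [Function.comp_apply, ← this, Function.comp_apply, hx']

end Riemannian

/-! ### Clarke gauges in a chart -/

/-- A continuous linear form has the same upper bounds on a set and on its closed convex hull. -/
lemma upperBounds_image_closure_convexHull {F : Type*} [AddCommGroup F] [Module ℝ F]
    [TopologicalSpace F] {l : F → ℝ} (hl : IsLinearMap ℝ l) (hlc : Continuous l) (S : Set F) :
    upperBounds (l '' closure (convexHull ℝ S)) = upperBounds (l '' S) := by
  refine (upperBounds_mono_set (image_mono ((subset_convexHull ℝ S).trans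
    subset_closure))).antisymm fun M hM ↦ ?_
  rintro _ ⟨p, hp, rfl⟩
  have h : S ⊆ {p | l p ≤ M} := fun p hp ↦ hM (mem_image_of_mem _ hp)
  exact closure_minimal (convexHull_min h (convex_halfSpace_le hl M))
    (isClosed_le hlc continuous_const) hp

section Chart

variable {E : Type*} [NormedAddCommGroup E] [NormedSpace ℝ E]
  {N : Type*} [TopologicalSpace N] [ChartedSpace E N]
  {u : N → ℝ} {g : E → ℝ} {x₀ x : N} {V : Set N}

lemma eventuallyEq_comp_extChartAt_symm (hV : IsOpen V) (hVs : V ⊆ (chartAt E x₀).source)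
    (hu : EqOn u (g ∘ extChartAt 𝓘(ℝ, E) x₀) V) (hx : x ∈ V) :
    g =ᶠ[𝓝 (extChartAt 𝓘(ℝ, E) x₀ x)] u ∘ (extChartAt 𝓘(ℝ, E) x₀).symm := by
  have hxs : x ∈ (extChartAt 𝓘(ℝ, E) x₀).source := by
    rw [extChartAt_source]; exact hVs hx
  filter_upwards [extChartAt_target_mem_nhds' ((extChartAt 𝓘(ℝ, E) x₀).map_source hxs),
    extChartAt_preimage_mem_nhds' hxs (hV.mem_nhds hx)] with y hy hyV
  rw [Function.comp_apply, hu hyV, Function.comp_apply, (extChartAt 𝓘(ℝ, E) x₀).right_inv hy]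

variable [IsManifold 𝓘(ℝ, E) ∞ N]

/-- The derivative `T_x N → E` at `x` of the preferred chart at `x₀`, as the trivialization of the
tangent bundle at `x₀`. -/
noncomputable def chartDeriv (x₀ x : N) : TangentSpace 𝓘(ℝ, E) x →L[ℝ] E :=
  (trivializationAt E (TangentSpace 𝓘(ℝ, E)) x₀).continuousLinearMapAt ℝ x

/-- The inverse `E → T_x N` of `chartDeriv x₀ x`, when `x` is in the domain of the chart. -/
noncomputable def chartDerivSymm (x₀ x : N) : E →L[ℝ] TangentSpace 𝓘(ℝ, E) x :=
  (trivializationAt E (TangentSpace 𝓘(ℝ, E)) x₀).symmL ℝ x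

lemma chartDeriv_chartDerivSymm {x₀ x : N} (hx : x ∈ (chartAt E x₀).source) (v : E) :
    chartDeriv x₀ x (chartDerivSymm x₀ x v) = v :=
  (trivializationAt E (TangentSpace 𝓘(ℝ, E)) x₀).continuousLinearMapAt_symmL hx v

lemma chartDerivSymm_chartDeriv {x₀ x : N} (hx : x ∈ (chartAt E x₀).source)
    (v : TangentSpace 𝓘(ℝ, E) x) : chartDerivSymm x₀ x (chartDeriv x₀ x v) = v :=
  (trivializationAt E (TangentSpace 𝓘(ℝ, E)) x₀).symmL_continuousLinearMapAt hx v

lemma hasMFDerivAt_extChartAt {x₀ x : N} (hx : x ∈ (chartAt E x₀).source) :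
    HasMFDerivAt 𝓘(ℝ, E) 𝓘(ℝ, E) (extChartAt 𝓘(ℝ, E) x₀) x (chartDeriv x₀ x) := by
  have := (mdifferentiableAt_extChartAt (I := 𝓘(ℝ, E)) hx).hasMFDerivAt
  rwa [← TangentBundle.continuousLinearMapAt_trivializationAt hx] at this

/-- The trivialization of the cotangent bundle at `x₀` reads a covector at `x` in the chart. -/
lemma trivializationAt_cotangent_apply {x₀ x : N} (p : Cotangent 𝓘(ℝ, E) x) :
    ((trivializationAt (E →L[ℝ] ℝ) (fun x : N ↦ Cotangent 𝓘(ℝ, E) x) x₀)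
      (⟨x, p⟩ : CotangentBundle 𝓘(ℝ, E) N)).2 = (p.comp (chartDerivSymm x₀ x) : E →L[ℝ] ℝ) := by
  rw [hom_trivializationAt_apply]
  ext v
  simp [ContinuousLinearMap.inCoordinates, chartDerivSymm]

lemma tendsto_cotangentBundle_iff {x₀ x : N} (hx : x ∈ (chartAt E x₀).source)
    {p : Cotangent 𝓘(ℝ, E) x} {y : ℕ → N} {q : ∀ n, Cotangent 𝓘(ℝ, E) (y n)} :
    Tendsto (fun n ↦ (⟨y n, q n⟩ : CotangentBundle 𝓘(ℝ, E) N)) atTop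
      (𝓝 (⟨x, p⟩ : CotangentBundle 𝓘(ℝ, E) N)) ↔
    Tendsto y atTop (𝓝 x) ∧
      Tendsto (fun n ↦ ((q n).comp (chartDerivSymm x₀ (y n)) : E →L[ℝ] ℝ)) atTop
        (𝓝 (p.comp (chartDerivSymm x₀ x) : E →L[ℝ] ℝ)) := by
  rw [(trivializationAt (E →L[ℝ] ℝ)
    (fun x : N ↦ Cotangent 𝓘(ℝ, E) x) x₀).tendsto_nhds_iff]
  · simp only [trivializationAt_cotangent_apply]
    rfl
  · rw [hom_trivializationAt_source]
    exact ⟨hx, mem_univ _⟩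

lemma mdifferentiableAt_iff_differentiableAt_chart (hV : IsOpen V)
    (hVs : V ⊆ (chartAt E x₀).source) (hu : EqOn u (g ∘ extChartAt 𝓘(ℝ, E) x₀) V) (hx : x ∈ V) :
    MDifferentiableAt 𝓘(ℝ, E) 𝓘(ℝ, ℝ) u x ↔
      DifferentiableAt ℝ g (extChartAt 𝓘(ℝ, E) x₀ x) := by
  have hxs : x ∈ (extChartAt 𝓘(ℝ, E) x₀).source := by
    rw [extChartAt_source]; exact hVs hx
  rw [← mdifferentiableAt_iff_differentiableAt]
  constructor <;> intro h
  · have h1 : MDifferentiableAt 𝓘(ℝ, E) 𝓘(ℝ, E) (extChartAt 𝓘(ℝ, E) x₀).symm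
        (extChartAt 𝓘(ℝ, E) x₀ x) := by
      have := mdifferentiableWithinAt_extChartAt_symm (I := 𝓘(ℝ, E))
        ((extChartAt 𝓘(ℝ, E) x₀).map_source hxs)
      rwa [modelWithCornersSelf_coe, range_id, mdifferentiableWithinAt_univ] at this
    rw [← (extChartAt 𝓘(ℝ, E) x₀).left_inv hxs] at h
    exact (h.comp _ h1).congr_of_eventuallyEq (eventuallyEq_comp_extChartAt_symm hV hVs hu hx)
  · exact (h.comp x (mdifferentiableAt_extChartAt (hVs hx))).congr_of_eventuallyEq
      (hu.eventuallyEq_of_mem (hV.mem_nhds hx))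

lemma differential_comp_chartDerivSymm (hV : IsOpen V) (hVs : V ⊆ (chartAt E x₀).source)
    (hu : EqOn u (g ∘ extChartAt 𝓘(ℝ, E) x₀) V) (hx : x ∈ V)
    (hg : DifferentiableAt ℝ g (extChartAt 𝓘(ℝ, E) x₀ x)) :
    ((differential 𝓘(ℝ, E) u x).comp (chartDerivSymm x₀ x) : E →L[ℝ] ℝ) =
      fderiv ℝ g (extChartAt 𝓘(ℝ, E) x₀ x) := by
  have h1 : HasMFDerivAt 𝓘(ℝ, E) 𝓘(ℝ, ℝ) u x
      ((fderiv ℝ g (extChartAt 𝓘(ℝ, E) x₀ x)).comp (chartDeriv x₀ x)) :=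
    (hg.hasFDerivAt.hasMFDerivAt.comp x (hasMFDerivAt_extChartAt (hVs hx))).congr_of_eventuallyEq
      (hu.eventuallyEq_of_mem (hV.mem_nhds hx))
  ext v
  have h2 : differential 𝓘(ℝ, E) u x (chartDerivSymm x₀ x v) =
      fderiv ℝ g (extChartAt 𝓘(ℝ, E) x₀ x) (chartDeriv x₀ x (chartDerivSymm x₀ x v)) :=
    congr($(h1.mfderiv) (chartDerivSymm x₀ x v))
  rw [chartDeriv_chartDerivSymm (hVs hx)] at h2
  exact h2

/-- The reachable derivatives of `u` are the pullbacks under the chart of the limiting derivatives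
of a local representative `g`. -/
lemma reachableDeriv_eq_image_limitingFDeriv (hV : IsOpen V) (hVs : V ⊆ (chartAt E x₀).source)
    (hu : EqOn u (g ∘ extChartAt 𝓘(ℝ, E) x₀) V) (hx : x ∈ V) :
    reachableDeriv 𝓘(ℝ, E) u x = (fun q : E →L[ℝ] ℝ ↦ (q.comp (chartDeriv x₀ x) :
      Cotangent 𝓘(ℝ, E) x)) '' limitingFDeriv g (extChartAt 𝓘(ℝ, E) x₀ x) := by
  have hxs : x ∈ (extChartAt 𝓘(ℝ, E) x₀).source := by
    rw [extChartAt_source]; exact hVs hx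
  ext p
  constructor
  · rintro ⟨y, hy, hyp⟩
    rw [tendsto_cotangentBundle_iff (hVs hx)] at hyp
    -- drop the first terms, so that the whole sequence lies in `V`
    obtain ⟨n₀, hn₀⟩ := eventually_atTop.1 (hyp.1.eventually (hV.mem_nhds hx))
    have hyV : ∀ n, y (n + n₀) ∈ V := fun n ↦ hn₀ _ (Nat.le_add_left _ _)
    have hyd : ∀ n, DifferentiableAt ℝ g (extChartAt 𝓘(ℝ, E) x₀ (y (n + n₀))) := fun n ↦
      (mdifferentiableAt_iff_differentiableAt_chart hV hVs hu (hyV n)).1 (hy _)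
    refine ⟨p.comp (chartDerivSymm x₀ x), ⟨fun n ↦ extChartAt 𝓘(ℝ, E) x₀ (y (n + n₀)), hyd,
      ((continuousAt_extChartAt' hxs).tendsto.comp hyp.1).comp (tendsto_add_atTop_nat n₀), ?_⟩, ?_⟩
    · refine ((tendsto_add_atTop_iff_nat n₀).2 hyp.2).congr fun n ↦ ?_
      exact differential_comp_chartDerivSymm hV hVs hu (hyV n) (hyd n)
    · ext v
      exact congrArg p (chartDerivSymm_chartDeriv (hVs hx) v)
  · rintro ⟨q, ⟨z, hz, hzx, hzq⟩, rfl⟩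
    have hsymm : Tendsto (fun n ↦ (extChartAt 𝓘(ℝ, E) x₀).symm (z n)) atTop (𝓝 x) := by
      have := (continuousAt_extChartAt_symm' hxs).tendsto.comp hzx
      rwa [(extChartAt 𝓘(ℝ, E) x₀).left_inv hxs] at this
    obtain ⟨n₀, hn₀⟩ := eventually_atTop.1 ((hsymm.eventually (hV.mem_nhds hx)).and
      (hzx.eventually (extChartAt_target_mem_nhds' ((extChartAt 𝓘(ℝ, E) x₀).map_source hxs))))
    have hV' : ∀ n, (extChartAt 𝓘(ℝ, E) x₀).symm (z (n + n₀)) ∈ V :=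
      fun n ↦ (hn₀ _ (Nat.le_add_left _ _)).1
    have hzn : ∀ n, extChartAt 𝓘(ℝ, E) x₀ ((extChartAt 𝓘(ℝ, E) x₀).symm (z (n + n₀))) =
        z (n + n₀) :=
      fun n ↦ (extChartAt 𝓘(ℝ, E) x₀).right_inv (hn₀ _ (Nat.le_add_left _ _)).2
    refine ⟨fun n ↦ (extChartAt 𝓘(ℝ, E) x₀).symm (z (n + n₀)), fun n ↦ ?_, ?_⟩
    · rw [mdifferentiableAt_iff_differentiableAt_chart hV hVs hu (hV' n), hzn]
      exact hz _
    · rw [tendsto_cotangentBundle_iff (hVs hx)]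
      refine ⟨(tendsto_add_atTop_iff_nat n₀).2 hsymm, ?_⟩
      have hq : ((q.comp (chartDeriv x₀ x)).comp (chartDerivSymm x₀ x) : E →L[ℝ] ℝ) = q := by
        ext v
        exact congrArg q (chartDeriv_chartDerivSymm (hVs hx) v)
      refine Tendsto.congr (fun n ↦ ?_)
        (((tendsto_add_atTop_iff_nat n₀).2 hzq).trans_eq (congrArg 𝓝 hq.symm))
      rw [differential_comp_chartDerivSymm hV hVs hu (hV' n) (by rw [hzn]; exact hz _), hzn]

lemma upperGauge_eq_limitingGauge [FiniteDimensional ℝ E] {K : NNReal} (hg : LipschitzWith K g)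
    (hV : IsOpen V) (hVs : V ⊆ (chartAt E x₀).source)
    (hu : EqOn u (g ∘ extChartAt 𝓘(ℝ, E) x₀) V) (hx : x ∈ V) (v : TangentSpace 𝓘(ℝ, E) x) :
    upperGauge 𝓘(ℝ, E) u x v =
      limitingGauge g (extChartAt 𝓘(ℝ, E) x₀ x) (chartDeriv x₀ x v) := by
  have himage : (fun p : Cotangent 𝓘(ℝ, E) x ↦ (p v : ℝ)) '' reachableDeriv 𝓘(ℝ, E) u x =
      (fun q : E →L[ℝ] ℝ ↦ q (chartDeriv x₀ x v)) ''
        limitingFDeriv g (extChartAt 𝓘(ℝ, E) x₀ x) := by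
    rw [reachableDeriv_eq_image_limitingFDeriv hV hVs hu hx, image_image]
    rfl
  have hne := (limitingFDeriv_nonempty hg (extChartAt 𝓘(ℝ, E) x₀ x)).image
    fun q : E →L[ℝ] ℝ ↦ q (chartDeriv x₀ x v)
  have hlub := isLUB_csSup hne (bddAbove_image_limitingFDeriv hg _ _)
  rw [← himage] at hne hlub
  rw [IsLUB, ← upperBounds_image_closure_convexHull (l := fun p : Cotangent 𝓘(ℝ, E) x ↦ (p v : ℝ))
    ⟨fun _ _ ↦ rfl, fun _ _ ↦ rfl⟩ (ContinuousEvalConst.continuous_eval_const v)] at hlub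
  rw [upperGauge, limitingGauge, ← himage]
  exact IsLUB.csSup_eq hlub (hne.mono (image_mono ((subset_convexHull ℝ _).trans subset_closure)))

/-- No boundedness is needed: the infimum of a set of reals is minus the supremum of the opposite
set, even where both take the default value. -/
lemma lowerGauge_eq_neg_upperGauge_neg (u : N → ℝ) (x : N) (v : TangentSpace 𝓘(ℝ, E) x) :
    lowerGauge 𝓘(ℝ, E) u x v = -upperGauge 𝓘(ℝ, E) u x (-v) := by
  rw [lowerGauge, upperGauge, Real.sInf_def, ← image_neg_eq_neg, image_image]
  congr 3
  ext p
  exact (map_neg p v).symm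

/-- The velocity of a path reads in a chart as the derivative of the path in that chart. -/
lemma chartDeriv_velocity {x₀ : N} {γ : ℝ → N} {a b t : ℝ} (ht : t ∈ Ioo a b)
    (hγ : ContinuousAt γ t) (hs : γ t ∈ (chartAt E x₀).source)
    (hd : DifferentiableAt ℝ (extChartAt 𝓘(ℝ, E) x₀ ∘ γ) t) :
    chartDeriv x₀ (γ t) (velocity 𝓘(ℝ, E) γ a b t) = deriv (extChartAt 𝓘(ℝ, E) x₀ ∘ γ) t := by
  have hxs : γ t ∈ (extChartAt 𝓘(ℝ, E) x₀).source := by rwa [extChartAt_source]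
  have h1 : MDifferentiableAt 𝓘(ℝ, E) 𝓘(ℝ, E) (extChartAt 𝓘(ℝ, E) x₀).symm
      ((extChartAt 𝓘(ℝ, E) x₀ ∘ γ) t) := by
    have := mdifferentiableWithinAt_extChartAt_symm (I := 𝓘(ℝ, E))
      ((extChartAt 𝓘(ℝ, E) x₀).map_source hxs)
    rwa [modelWithCornersSelf_coe, range_id, mdifferentiableWithinAt_univ] at this
  have h2 : MDifferentiableAt 𝓘(ℝ, ℝ) 𝓘(ℝ, E) γ t := by
    refine (h1.comp t hd.mdifferentiableAt).congr_of_eventuallyEq ?_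
    filter_upwards [hγ.preimage_mem_nhds ((chartAt E x₀).open_source.mem_nhds hs)] with s hs'
    refine ((extChartAt 𝓘(ℝ, E) x₀).left_inv ?_).symm
    rwa [extChartAt_source]
  have h3 := ((hasMFDerivAt_extChartAt hs).comp t h2.hasMFDerivAt).mfderiv
  rw [mfderiv_eq_fderiv] at h3
  rw [velocity, mfderivWithin_of_mem_nhds (Icc_mem_nhds ht.1 ht.2), ← fderiv_apply_one_eq_deriv]
  exact congr($h3.symm (1 : ℝ))

end Chart

end ClarkeCalculus

/-! ### Absolutely continuous paths -/

lemma LipschitzOnWith.comp_absolutelyContinuousOnInterval {X Y : Type*} [PseudoMetricSpace X]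
    [PseudoMetricSpace Y] {K : NNReal} {f : X → Y} {s : Set X} {γ : ℝ → X} {a b : ℝ}
    (hf : LipschitzOnWith K f s) (hγ : AbsolutelyContinuousOnInterval γ a b)
    (hs : MapsTo γ (uIcc a b) s) : AbsolutelyContinuousOnInterval (f ∘ γ) a b := by
  rw [absolutelyContinuousOnInterval_iff] at hγ ⊢
  intro ε hε
  obtain ⟨δ, hδ, h⟩ := hγ (ε / (K + 1)) (by positivity)
  refine ⟨δ, hδ, fun J hJ hJδ ↦ ?_⟩
  calc ∑ i ∈ Finset.range J.1, dist ((f ∘ γ) (J.2 i).1) ((f ∘ γ) (J.2 i).2)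
      ≤ ∑ i ∈ Finset.range J.1, (K + 1 : ℝ) * dist (γ (J.2 i).1) (γ (J.2 i).2) := by
        refine Finset.sum_le_sum fun i hi ↦ ?_
        have hm := hJ.1 i hi
        refine (hf.dist_le_mul _ (hs hm.1) _ (hs hm.2)).trans ?_
        gcongr
        linarith
    _ = (K + 1 : ℝ) * ∑ i ∈ Finset.range J.1, dist (γ (J.2 i).1) (γ (J.2 i).2) := by
        rw [Finset.mul_sum]
    _ < (K + 1 : ℝ) * (ε / (K + 1)) := by
        gcongr
        exact h J hJ hJδ
    _ = ε := by field_simp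

/-- Version of `AbsolutelyContinuousOnInterval.continuousOn` for paths in a metric space. -/
lemma AbsolutelyContinuousOnInterval.continuousOn_of_metric {X : Type*} [PseudoMetricSpace X]
    {γ : ℝ → X} {a b : ℝ} (hγ : AbsolutelyContinuousOnInterval γ a b) :
    ContinuousOn γ (uIcc a b) := by
  rw [absolutelyContinuousOnInterval_iff] at hγ
  rw [Metric.continuousOn_iff]
  intro t ht ε hε
  obtain ⟨δ, hδ, h⟩ := hγ ε hε
  refine ⟨δ, hδ, fun s hs hst ↦ ?_⟩
  -- a single interval is a family of disjoint intervals
  have := h (1, fun _ ↦ (s, t)) (by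
    simp [AbsolutelyContinuousOnInterval.disjWithin, hs, ht]) (by simpa using hst)
  simpa using this

namespace ClarkeCalculus

section Curve

open scoped NNReal

variable {E : Type*} [NormedAddCommGroup E] [NormedSpace ℝ E] [FiniteDimensional ℝ E]

/-- Vector-valued version of `AbsolutelyContinuousOnInterval.intervalIntegrable_deriv`, obtained by
reading the path in a basis. -/
lemma intervalIntegrable_deriv_of_absolutelyContinuousOnInterval {c : ℝ → E} {a b : ℝ}
    (hc : AbsolutelyContinuousOnInterval c a b) : IntervalIntegrable (deriv c) volume a b := by
  let B := Module.finBasis ℝ E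
  let l := fun i ↦ (B.coord i).toContinuousLinearMap
  have hac : ∀ i, AbsolutelyContinuousOnInterval (l i ∘ c) a b := fun i ↦
    ((l i).lipschitz.lipschitzOnWith (s := univ)).comp_absolutelyContinuousOnInterval hc
      (mapsTo_univ _ _)
  have hint : IntervalIntegrable (fun t ↦ ∑ i, deriv (l i ∘ c) t • B i) volume a b := by
    rw [← Finset.sum_fn]
    refine IntervalIntegrable.sum _ fun i _ ↦ ?_
    have := (hac i).intervalIntegrable_deriv
    exact ⟨this.1.smul_const _, this.2.smul_const _⟩
  refine hint.congr_ae ?_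
  rw [EventuallyEq, ae_restrict_iff' measurableSet_uIoc]
  filter_upwards [hc.boundedVariationOn.ae_differentiableAt_of_mem_uIcc] with t ht htm
  have hd := (ht (uIoc_subset_uIcc htm)).hasDerivAt
  have h1 : ∀ i, deriv (l i ∘ c) t = B.coord i (deriv c t) := fun i ↦
    ((l i).hasFDerivAt.comp_hasDerivAt t hd).deriv
  simp only [h1]
  exact B.sum_repr (deriv c t)

lemma integrableOn_limitingGauge {g : E → ℝ} {K : ℝ≥0} (hg : LipschitzWith K g) {c w : ℝ → E}
    {s : Set ℝ} (hs : MeasurableSet s) (hc : ContinuousOn c s) (hw : IntegrableOn w s) :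
    IntegrableOn (fun t ↦ limitingGauge g (c t) (w t)) s := by
  borelize E
  have : ProperSpace E := FiniteDimensional.proper ℝ E
  have : SecondCountableTopology E := secondCountable_of_proper
  have hm : AEMeasurable (fun t ↦ limitingGauge g (c t) (w t)) (volume.restrict s) :=
    (upperSemicontinuous_limitingGauge hg).measurable.comp_aemeasurable
      ((hc.aemeasurable hs).prodMk hw.aestronglyMeasurable.aemeasurable)
  exact (hw.norm.const_mul K).mono' hm.aestronglyMeasurable
    (.of_forall fun t ↦ abs_limitingGauge_le hg _ _)

variable {N : Type*} [MetricSpace N] [ChartedSpace E N] [IsManifold 𝓘(ℝ, E) ∞ N]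
  {u : N → ℝ} {g : E → ℝ} {K K' : ℝ≥0} {x₀ : N} {V : Set N} {γ : ℝ → N}

/-- The claim on an interval that the path spends in one chart domain, where both the chart and the
representative of `u` are Lipschitz. -/
lemma integrableOn_upperGauge_and_ae_deriv_le (hV : IsOpen V) (hVs : V ⊆ (chartAt E x₀).source)
    (hφ : LipschitzOnWith K' (extChartAt 𝓘(ℝ, E) x₀) V) (hg : LipschitzWith K g)
    (hu : EqOn u (g ∘ extChartAt 𝓘(ℝ, E) x₀) V) {a b c d : ℝ} (hcd : c ≤ d)
    (hsub : Icc c d ⊆ Icc a b) (hγ : AbsolutelyContinuousOnInterval γ c d)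
    (hγV : MapsTo γ (Icc c d) V) :
    IntegrableOn (fun t ↦ upperGauge 𝓘(ℝ, E) u (γ t) (velocity 𝓘(ℝ, E) γ a b t)) (Icc c d) ∧
    IntegrableOn (fun t ↦ upperGauge 𝓘(ℝ, E) u (γ t) (-velocity 𝓘(ℝ, E) γ a b t)) (Icc c d) ∧
    ∀ᵐ t ∂volume.restrict (Icc c d),
      -upperGauge 𝓘(ℝ, E) u (γ t) (-velocity 𝓘(ℝ, E) γ a b t) ≤ deriv (u ∘ γ) t ∧
      deriv (u ∘ γ) t ≤ upperGauge 𝓘(ℝ, E) u (γ t) (velocity 𝓘(ℝ, E) γ a b t) := by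
  set C := extChartAt 𝓘(ℝ, E) x₀ ∘ γ with hC
  have hCac : AbsolutelyContinuousOnInterval C c d :=
    hφ.comp_absolutelyContinuousOnInterval hγ (by rwa [uIcc_of_le hcd])
  have hgac : AbsolutelyContinuousOnInterval (g ∘ C) c d :=
    (hg.lipschitzOnWith (s := univ)).comp_absolutelyContinuousOnInterval hCac (mapsTo_univ _ _)
  have hCcont : ContinuousOn C (Icc c d) := by
    rw [← uIcc_of_le hcd]; exact hCac.continuousOn
  have hderiv : IntegrableOn (deriv C) (Icc c d) :=
    (intervalIntegrable_iff_integrableOn_Icc_of_le hcd).1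
      (intervalIntegrable_deriv_of_absolutelyContinuousOnInterval hCac)
  have hae : ∀ᵐ t ∂volume.restrict (Icc c d), t ∈ Ioo c d ∧ DifferentiableAt ℝ C t ∧
      DifferentiableAt ℝ (g ∘ C) t := by
    rw [← restrict_Ioo_eq_restrict_Icc, ae_restrict_iff' measurableSet_Ioo]
    filter_upwards [hCac.boundedVariationOn.ae_differentiableAt_of_mem_uIcc,
      hgac.ae_differentiableAt] with t h1 h2 ht
    have ht' : t ∈ uIcc c d := by rw [uIcc_of_le hcd]; exact Ioo_subset_Icc_self ht
    exact ⟨ht, h1 ht', h2 ht'⟩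
  have hvel : ∀ t ∈ Ioo c d, DifferentiableAt ℝ C t →
      chartDeriv x₀ (γ t) (velocity 𝓘(ℝ, E) γ a b t) = deriv C t := by
    intro t ht hd
    have hcont : ContinuousOn γ (Icc c d) := by
      rw [← uIcc_of_le hcd]; exact hγ.continuousOn_of_metric
    refine chartDeriv_velocity ?_ (hcont.continuousAt (Icc_mem_nhds ht.1 ht.2))
      (hVs (hγV (Ioo_subset_Icc_self ht))) hd
    have hc := hsub (left_mem_Icc.2 hcd)
    have hd := hsub (right_mem_Icc.2 hcd)
    exact ⟨hc.1.trans_lt ht.1, ht.2.trans_le hd.2⟩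
  have hgauge : ∀ t ∈ Icc c d, ∀ v, upperGauge 𝓘(ℝ, E) u (γ t) v =
      limitingGauge g (C t) (chartDeriv x₀ (γ t) v) := fun t ht v ↦
    upperGauge_eq_limitingGauge hg hV hVs hu (hγV ht) v
  refine ⟨(integrableOn_limitingGauge hg measurableSet_Icc hCcont hderiv).congr ?_,
    (integrableOn_limitingGauge hg measurableSet_Icc hCcont hderiv.neg).congr ?_, ?_⟩
  · filter_upwards [hae] with t ⟨ht, hd, _⟩
    rw [hgauge t (Ioo_subset_Icc_self ht), hvel t ht hd]
  · filter_upwards [hae] with t ⟨ht, hd, _⟩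
    rw [hgauge t (Ioo_subset_Icc_self ht), map_neg, hvel t ht hd, Pi.neg_apply]
  · filter_upwards [hae] with t ⟨ht, hd, hgd⟩
    rw [hgauge t (Ioo_subset_Icc_self ht), hgauge t (Ioo_subset_Icc_self ht), map_neg,
      hvel t ht hd]
    have heq : u ∘ γ =ᶠ[𝓝 t] g ∘ C := by
      filter_upwards [Icc_mem_nhds ht.1 ht.2] with s hs using hu (hγV hs)
    rw [heq.deriv_eq]
    refine ⟨?_, deriv_comp_le_limitingGauge hg hd.hasDerivAt hgd.hasDerivAt⟩
    -- the lower bound is the upper bound for the path run backwards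
    have hneg : HasDerivAt (fun s : ℝ ↦ -s) (-1) (-t) := hasDerivAt_neg _
    have h1 : HasDerivAt (fun s ↦ C (-s)) (-deriv C t) (-t) := by
      have := HasDerivAt.scomp (-t) (by rw [neg_neg]; exact hd.hasDerivAt) hneg
      simpa [Function.comp_def] using this
    have h2 : HasDerivAt (fun s ↦ g (C (-s))) (-deriv (g ∘ C) t) (-t) := by
      have := HasDerivAt.scomp (-t) (by rw [neg_neg]; exact hgd.hasDerivAt) hneg
      simpa [Function.comp_def] using this
    have h3 := deriv_comp_le_limitingGauge hg h1 h2
    rw [neg_neg] at h3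
    linarith

/-- The local estimates along the path, glued over the compact interval `[a, b]`. -/
lemma integrableOn_upperGauge_and_ae_deriv_le_Icc
    [RiemannianBundle (fun x : N ↦ TangentSpace 𝓘(ℝ, E) x)]
    [IsContMDiffRiemannianBundle 𝓘(ℝ, E) ∞ E (fun x : N ↦ TangentSpace 𝓘(ℝ, E) x)]
    [IsRiemannianManifold 𝓘(ℝ, E) N] (hu : LocallyLipschitz u) {a b : ℝ} (hab : a ≤ b)
    (hγ : AbsolutelyContinuousOnInterval γ a b) :
    IntegrableOn (fun t ↦ upperGauge 𝓘(ℝ, E) u (γ t) (velocity 𝓘(ℝ, E) γ a b t)) (Icc a b) ∧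
    IntegrableOn (fun t ↦ upperGauge 𝓘(ℝ, E) u (γ t) (-velocity 𝓘(ℝ, E) γ a b t)) (Icc a b) ∧
    ∀ᵐ t ∂volume.restrict (Icc a b),
      -upperGauge 𝓘(ℝ, E) u (γ t) (-velocity 𝓘(ℝ, E) γ a b t) ≤ deriv (u ∘ γ) t ∧
      deriv (u ∘ γ) t ≤ upperGauge 𝓘(ℝ, E) u (γ t) (velocity 𝓘(ℝ, E) γ a b t) := by
  have hcont : ContinuousOn γ (Icc a b) := by
    rw [← uIcc_of_le hab]; exact hγ.continuousOn_of_metric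
  refine isCompact_Icc.induction_on (p := fun s ↦
    IntegrableOn (fun t ↦ upperGauge 𝓘(ℝ, E) u (γ t) (velocity 𝓘(ℝ, E) γ a b t)) s ∧
    IntegrableOn (fun t ↦ upperGauge 𝓘(ℝ, E) u (γ t) (-velocity 𝓘(ℝ, E) γ a b t)) s ∧
    ∀ᵐ t ∂volume.restrict s,
      -upperGauge 𝓘(ℝ, E) u (γ t) (-velocity 𝓘(ℝ, E) γ a b t) ≤ deriv (u ∘ γ) t ∧
      deriv (u ∘ γ) t ≤ upperGauge 𝓘(ℝ, E) u (γ t) (velocity 𝓘(ℝ, E) γ a b t)) ?_ ?_ ?_ ?_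
  · simp
  · exact fun s t hst h ↦ ⟨h.1.mono_set hst, h.2.1.mono_set hst,
      ae_restrict_of_ae_restrict_of_subset hst h.2.2⟩
  · exact fun s t hs ht ↦ ⟨hs.1.union ht.1, hs.2.1.union ht.2.1,
      (ae_restrict_union_iff s t _).2 ⟨hs.2.2, ht.2.2⟩⟩
  · intro t₀ ht₀
    obtain ⟨K, K', g, V, hV, hxV, hVs, hφ, hg, hug⟩ :=
      exists_lipschitz_representative (E := E) hu (γ t₀)
    have hnhds : γ ⁻¹' V ∈ 𝓝[Icc a b] t₀ := (hcont t₀ ht₀).preimage_mem_nhdsWithin (hV.mem_nhds hxV)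
    obtain ⟨δ, hδ, hball⟩ :=
      (nhdsWithin_hasBasis Metric.nhds_basis_closedBall _).mem_iff.1 hnhds
    rw [Real.closedBall_eq_Icc, Icc_inter_Icc] at hball
    have hsub : Icc ((t₀ - δ) ⊔ a) ((t₀ + δ) ⊓ b) ⊆ Icc a b :=
      Icc_subset_Icc le_sup_right inf_le_right
    have hle : (t₀ - δ) ⊔ a ≤ (t₀ + δ) ⊓ b :=
      le_inf (sup_le (by linarith) (by linarith [ht₀.1])) (sup_le (by linarith [ht₀.2]) hab)
    refine ⟨Icc ((t₀ - δ) ⊔ a) ((t₀ + δ) ⊓ b), ?_,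
      integrableOn_upperGauge_and_ae_deriv_le hV hVs hφ hg hug hle hsub (hγ.mono ?_) hball⟩
    · rw [← Icc_inter_Icc, inter_comm]
      exact inter_mem self_mem_nhdsWithin
        (nhdsWithin_le_nhds (Icc_mem_nhds (by linarith) (by linarith)))
    · rwa [uIcc_of_le hle, uIcc_of_le hab]

end Curve

end ClarkeCalculus

theorem mainTheorem4
    {E : Type*} [NormedAddCommGroup E] [NormedSpace ℝ E] [FiniteDimensional ℝ E]
    {N : Type*} [MetricSpace N] [ChartedSpace E N] [IsManifold 𝓘(ℝ, E) ∞ N] [ConnectedSpace N]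
    [RiemannianBundle (fun x : N ↦ TangentSpace 𝓘(ℝ, E) x)]
    [IsContMDiffRiemannianBundle 𝓘(ℝ, E) ∞ E (fun x : N ↦ TangentSpace 𝓘(ℝ, E) x)]
    [IsRiemannianManifold 𝓘(ℝ, E) N]
    (u : N → ℝ) (hu : LocallyLipschitz u)
    (a b : ℝ) (hab : a ≤ b)
    (γ : ℝ → N) (hγ : AbsolutelyContinuousOnInterval γ a b) :
    IntervalIntegrable (fun t ↦ ClarkeCalculus.lowerGauge 𝓘(ℝ, E) u (γ t)
        (ClarkeCalculus.velocity 𝓘(ℝ, E) γ a b t)) volume a b ∧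
    IntervalIntegrable (fun t ↦ ClarkeCalculus.upperGauge 𝓘(ℝ, E) u (γ t)
        (ClarkeCalculus.velocity 𝓘(ℝ, E) γ a b t)) volume a b ∧
    ∫ t in a..b, ClarkeCalculus.lowerGauge 𝓘(ℝ, E) u (γ t)
        (ClarkeCalculus.velocity 𝓘(ℝ, E) γ a b t) ≤ u (γ b) - u (γ a) ∧
    u (γ b) - u (γ a) ≤ ∫ t in a..b, ClarkeCalculus.upperGauge 𝓘(ℝ, E) u (γ t)
        (ClarkeCalculus.velocity 𝓘(ℝ, E) γ a b t) := by
  obtain ⟨hup, hneg, hae⟩ :=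
    ClarkeCalculus.integrableOn_upperGauge_and_ae_deriv_le_Icc (E := E) hu hab hγ
  have hlow := hneg.neg
  simp only [ClarkeCalculus.lowerGauge_eq_neg_upperGauge_neg]
  rw [← intervalIntegrable_iff_integrableOn_Icc_of_le hab] at hup hlow
  have hcompact : IsCompact (γ '' uIcc a b) := isCompact_uIcc.image_of_continuousOn
    hγ.continuousOn_of_metric
  obtain ⟨K, hK⟩ := LocallyLipschitzOn.exists_lipschitzOnWith_of_compact hcompact
    (LocallyLipschitz.locallyLipschitzOn hu)
  have hac : AbsolutelyContinuousOnInterval (u ∘ γ) a b :=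
    hK.comp_absolutelyContinuousOnInterval hγ (mapsTo_image _ _)
  have hftc : ∫ t in a..b, deriv (u ∘ γ) t = u (γ b) - u (γ a) := hac.integral_deriv_eq_sub
  refine ⟨hlow, hup, ?_, ?_⟩
  · rw [← hftc]
    exact intervalIntegral.integral_mono_ae_restrict hab hlow hac.intervalIntegrable_deriv
      (hae.mono fun t ht ↦ ht.1)
  · rw [← hftc]
    exact intervalIntegral.integral_mono_ae_restrict hab hac.intervalIntegrable_deriv hup
      (hae.mono fun t ht ↦ ht.2)
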